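/- Let $K$ be an algebraically closed field of characteristic zero, let $E$ be a $K$-vector space with basis $e_1,\dots,e_n$, and let $\mathfrak{g}=\mathfrak{sl}(E)$ be the Lie algebra of endomorphisms of $E$ of trace zero. Let $\mathfrak{h}\subseteq\mathfrak{g}$ (respectively $\mathfrak{n}_+\subseteq\mathfrak{g}$) be the subalgebra of those elements whose matrix in the basis $e_1,\dots,e_n$ is diagonal (respectively strictly upper triangular). For $1\le i\le n$ let $L_i\in\mathfrak{h}^*$ be the $i$-th diagonal entry, and for $1\le m\le n-1$ let $\omega_m=L_1+\cdots+L_m$ be the fundamental weights. Let $k\ge 0$, let $1\le n_1<n_2<\cdots<n_k\le n-1$ and $l_1,\dots,l_k\ge 1$ be integers, and put $\lambda=\sum_{i=1}^k l_i\omega_{n_i}\in\mathfrak{h}^*$. Let $$W=\operatorname{Sym}^{l_1}(\wedge^{n_1}E)\otimes\cdots\otimes\operatorname{Sym}^{l_k}(\wedge^{n_k}E)$$ with the $\mathfrak{g}$-module structure induced from $E$ (for $k=0$, $W=K$ is the trivial module). Let $E_i$ be the span of $e_1,\dots,e_{n_i}$, let $w_i$ be a nonzero element of the line $\wedge^{n_i}E_i\subseteq\wedge^{n_i}E$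 (for example $w_i=e_1\wedge\cdots\wedge e_{n_i}$), let $v=w_1^{l_1}\otimes\cdots\otimes w_k^{l_k}\in W$, and let $V_\lambda\subseteq W$ be the $\mathfrak{g}$-submodule generated by $v$. Then the $\mathfrak{g}$-module $V_\lambda$ is finite-dimensional and irreducible, and $v$ is a highest weight vector for $V_\lambda$ with highest weight $\lambda$; that is, $v\ne 0$, $x v=\lambda(x)v$ for all $x\in\mathfrak{h}$, $x v=0$ for all $x\in\mathfrak{n}_+$, and $v$ generates $V_\lambda$ as a $\mathfrak{g}$-module. -/

import Mathlib

open scoped TensorProduct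

noncomputable section

namespace SLHighest

/-! ### Exterior powers of a Lie module -/

section Exterior

attribute [local instance 100] LieRing.ofAssociativeRing

variable {K : Type*} [CommRing K] {M : Type*} [AddCommGroup M] [Module K M]

/-- The alternating map `(a₁, …, aₘ) ↦ ∑ i, a₁ ∧ ⋯ ∧ f aᵢ ∧ ⋯ ∧ aₘ`. -/
def extDerivAlt (m : ℕ) (f : Module.End K M) : M [⋀^Fin m]→ₗ[K] ⋀[K]^m M where
  toMultilinearMap := ∑ i : Fin m,
    (exteriorPower.ιMulti K m (M := M)).toMultilinearMap.compLinearMap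
      (Function.update (fun _ => LinearMap.id) i f)
  map_eq_zero_of_eq' := by
    intro a p q hpq hne
    have key : ∀ i, (fun j => (Function.update (fun _ => LinearMap.id) i f :
        Fin m → M →ₗ[K] M) j (a j)) = Function.update a i (f (a i)) := by
      intro i
      funext j
      by_cases h : j = i
      · subst h; simp
      · simp [h]
    simp only [MultilinearMap.toFun_eq_coe, sum_apply,
      MultilinearMap.compLinearMap_apply, key, AlternatingMap.coe_multilinearMap]
    rw [← Finset.add_sum_erase _ _ (Finset.mem_univ p),
      ← Finset.add_sum_erase _ _ (Finset.mem_erase.2 ⟨hne.symm, Finset.mem_univ q⟩)]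
    rw [Finset.sum_eq_zero, add_zero]
    · have : Function.update a q (f (a q)) =
          (Function.update a p (f (a p))) ∘ Equiv.swap p q := by
        funext j
        by_cases hp : j = p
        · subst hp; simp [hne, hne.symm, hpq]
        · by_cases hq : j = q
          · subst hq; simp [hpq]
          · simp [hp, hq, Equiv.swap_apply_of_ne_of_ne hp hq]
      rw [this, AlternatingMap.map_swap _ _ hne, add_neg_cancel]
    · intro i hi
      simp only [Finset.mem_erase, Finset.mem_univ, and_true] at hi
      refine AlternatingMap.map_eq_zero_of_eq _ _ (i := p) (j := q) ?_ hne
      simp [Ne.symm hi.1, Ne.symm hi.2, hpq]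

theorem extDerivAlt_apply (m : ℕ) (f : Module.End K M) (a : Fin m → M) :
    extDerivAlt m f a = ∑ i, exteriorPower.ιMulti K m (Function.update a i (f (a i))) := by
  have key : ∀ i, (fun j => (Function.update (fun _ => LinearMap.id) i f :
      Fin m → M →ₗ[K] M) j (a j)) = Function.update a i (f (a i)) := by
    intro i
    funext j
    by_cases h : j = i
    · subst h; simp
    · simp [h]
  change (∑ i : Fin m, (exteriorPower.ιMulti K m (M := M)).toMultilinearMap.compLinearMap
      (Function.update (fun _ => LinearMap.id) i f)) a = _
  simp only [sum_apply,
      MultilinearMap.compLinearMap_apply, key, AlternatingMap.coe_multilinearMap]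

/-- The endomorphism of `⋀ᵐ M` induced by `f`, acting as a derivation on wedge products. -/
def extDeriv (m : ℕ) (f : Module.End K M) : Module.End K (⋀[K]^m M) :=
  exteriorPower.alternatingMapLinearEquiv (extDerivAlt m f)

theorem extDeriv_ιMulti (m : ℕ) (f : Module.End K M) (a : Fin m → M) :
    extDeriv m f (exteriorPower.ιMulti K m a) =
      ∑ i, exteriorPower.ιMulti K m (Function.update a i (f (a i))) := by
  rw [extDeriv, exteriorPower.alternatingMapLinearEquiv_apply_ιMulti, extDerivAlt_apply]

/-- `f ↦ extDeriv m f` as a homomorphism of Lie algebras. -/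
def extHom (m : ℕ) : Module.End K M →ₗ⁅K⁆ Module.End K (⋀[K]^m M) where
  toFun := extDeriv m
  map_add' f g := by
    apply exteriorPower.linearMap_ext
    ext1 a
    simp [extDeriv_ιMulti, Finset.sum_add_distrib]
  map_smul' c f := by
    apply exteriorPower.linearMap_ext
    ext1 a
    simp [extDeriv_ιMulti, Finset.smul_sum]
  map_lie' := by
    intro f g
    apply exteriorPower.linearMap_ext
    ext1 a
    simp only [LinearMap.compAlternatingMap_apply, extDeriv_ιMulti, LieRing.of_associative_ring_bracket,
      LinearMap.sub_apply, Module.End.mul_apply, map_sum, AlternatingMap.map_update_sub,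
      Finset.sum_sub_distrib]
    have hd : ∀ f g : Module.End K M, ∀ i, ∑ j, exteriorPower.ιMulti K m (Function.update
        (Function.update a i (g (a i))) j (f (Function.update a i (g (a i)) j))) =
        exteriorPower.ιMulti K m (Function.update a i (f (g (a i)))) +
          ∑ j, if j = i then 0 else exteriorPower.ιMulti K m (Function.update
        (Function.update a i (g (a i))) j (f (a j))) := by
      intro f g i
      rw [← Finset.add_sum_erase _ _ (Finset.mem_univ i),
        ← Finset.add_sum_erase _ (fun j => if j = i then (0 : ⋀[K]^m M) else _)
          (Finset.mem_univ i)]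
      simp only [Function.update_self, Function.update_idem, if_true, zero_add]
      congr 1
      refine Finset.sum_congr rfl fun j hj => ?_
      have hj' : j ≠ i := (Finset.mem_erase.1 hj).1
      simp [hj']
    simp only [hd, Finset.sum_add_distrib]
    have hc : (∑ i, ∑ j, if j = i then (0 : ⋀[K]^m M) else exteriorPower.ιMulti K m (Function.update
        (Function.update a i (g (a i))) j (f (a j)))) =
        ∑ i, ∑ j, if j = i then (0 : ⋀[K]^m M) else exteriorPower.ιMulti K m (Function.update
        (Function.update a i (f (a i))) j (g (a j))) := by
      rw [Finset.sum_comm]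
      refine Finset.sum_congr rfl fun i _ => Finset.sum_congr rfl fun j _ => ?_
      by_cases h : i = j
      · simp [h]
      · rw [if_neg h, if_neg (Ne.symm h), Function.update_comm (Ne.symm h)]
    rw [hc]
    abel

variable {L : Type*} [LieRing L] [LieAlgebra K L] [LieRingModule L M] [LieModule K L M]

instance extLieRingModule (m : ℕ) : LieRingModule L (⋀[K]^m M) :=
  LieRingModule.compLieHom _ ((extHom (K := K) (M := M) m).comp (LieModule.toEnd K L M))

instance extLieModule (m : ℕ) : LieModule K L (⋀[K]^m M) :=
  LieModule.compLieHom _ ((extHom (K := K) (M := M) m).comp (LieModule.toEnd K L M))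

/-- The action on `⋀ᵐ M`: `x • (a₁ ∧ ⋯ ∧ aₘ) = ∑ i, a₁ ∧ ⋯ ∧ x • aᵢ ∧ ⋯ ∧ aₘ`. -/
theorem lie_ιMulti (m : ℕ) (x : L) (a : Fin m → M) :
    ⁅x, exteriorPower.ιMulti K m a⁆ =
      ∑ i, exteriorPower.ιMulti K m (Function.update a i ⁅x, a i⁆) :=
  extDeriv_ιMulti m (LieModule.toEnd K L M x) a

end Exterior

/-! ### Symmetric powers of a Lie module -/

section Symmetric

attribute [local instance 100] LieRing.ofAssociativeRing

variable {K : Type*} [CommRing K] {M : Type*} [AddCommGroup M] [Module K M]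

variable (K M) in
/-- The `l`-th symmetric power: the degree `l` part of the symmetric algebra. -/
abbrev SymPow (l : ℕ) : Submodule K (SymmetricAlgebra K M) :=
  LinearMap.range (SymmetricAlgebra.ι K M) ^ l

/-- The algebra map `a ↦ a + ε D(a)` into the dual numbers, determined by `D = f` on `M`. -/
def symDual (f : Module.End K M) : SymmetricAlgebra K M →ₐ[K] DualNumber (SymmetricAlgebra K M) :=
  SymmetricAlgebra.lift
    ((TrivSqZeroExt.inlAlgHom K (SymmetricAlgebra K M) (SymmetricAlgebra K M)).toLinearMap ∘ₗ
        SymmetricAlgebra.ι K M +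
      (TrivSqZeroExt.inrHom (SymmetricAlgebra K M) (SymmetricAlgebra K M)).restrictScalars K ∘ₗ
        SymmetricAlgebra.ι K M ∘ₗ f)

theorem symDual_ι (f : Module.End K M) (a : M) :
    symDual f (SymmetricAlgebra.ι K M a) =
      TrivSqZeroExt.inl (SymmetricAlgebra.ι K M a) +
        TrivSqZeroExt.inr (SymmetricAlgebra.ι K M (f a)) := by
  simp [symDual]

theorem fst_symDual (f : Module.End K M) (a : SymmetricAlgebra K M) :
    (symDual f a).fst = a := by
  have : (TrivSqZeroExt.fstHom K (SymmetricAlgebra K M) (SymmetricAlgebra K M)).comp (symDual f) =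
      AlgHom.id K _ := by
    apply SymmetricAlgebra.algHom_ext
    ext a
    simp [symDual_ι]
  exact DFunLike.congr_fun this a

/-- The derivation of the symmetric algebra extending the endomorphism `f` of `M`. -/
def symDeriv (f : Module.End K M) :
    Derivation K (SymmetricAlgebra K M) (SymmetricAlgebra K M) :=
  Derivation.mk'
    ((TrivSqZeroExt.sndHom (SymmetricAlgebra K M) (SymmetricAlgebra K M)).restrictScalars K ∘ₗ
      (symDual f).toLinearMap) (by
    intro a b
    simp [fst_symDual, mul_comm])

theorem symDeriv_ι (f : Module.End K M) (a : M) :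
    symDeriv f (SymmetricAlgebra.ι K M a) = SymmetricAlgebra.ι K M (f a) := by
  simp [symDeriv, symDual_ι]

theorem symDerivation_ext {D₁ D₂ : Derivation K (SymmetricAlgebra K M) (SymmetricAlgebra K M)}
    (h : ∀ a, D₁ (SymmetricAlgebra.ι K M a) = D₂ (SymmetricAlgebra.ι K M a)) : D₁ = D₂ := by
  ext a
  induction a using SymmetricAlgebra.induction with
  | algebraMap r => simp
  | ι x => exact h x
  | mul a b ha hb => simp [ha, hb]
  | add a b ha hb => simp [ha, hb]

theorem symDeriv_mem (f : Module.End K M) (l : ℕ) (a : SymmetricAlgebra K M)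
    (ha : a ∈ SymPow K M l) : symDeriv f a ∈ SymPow K M l := by
  induction ha using Submodule.pow_induction_on_left' with
  | algebraMap r => simp
  | add x y i hx hy ihx ihy => rw [map_add]; exact add_mem ihx ihy
  | mem_mul m hm i x hx ih =>
    obtain ⟨m, rfl⟩ := hm
    rw [Derivation.leibniz, smul_eq_mul, smul_eq_mul, symDeriv_ι, SymPow, pow_succ']
    refine add_mem (Submodule.mul_mem_mul (LinearMap.mem_range_self _ m) ih) ?_
    rw [mul_comm x]
    exact Submodule.mul_mem_mul (LinearMap.mem_range_self _ (f m)) hx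

/-- `f ↦ symDeriv f`, restricted to the symmetric power, as a homomorphism of Lie algebras. -/
def symHom (l : ℕ) : Module.End K M →ₗ⁅K⁆ Module.End K (SymPow K M l) where
  toFun f := (symDeriv f).toLinearMap.restrict (symDeriv_mem f l)
  map_add' f g := by
    have : symDeriv (f + g) = symDeriv f + symDeriv g :=
      symDerivation_ext fun a => by simp [symDeriv_ι]
    ext a
    simp [LinearMap.restrict_apply, this]
  map_smul' c f := by
    have : symDeriv (c • f) = c • symDeriv f :=
      symDerivation_ext fun a => by simp [symDeriv_ι]
    ext a
    simp [LinearMap.restrict_apply, this]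
  map_lie' := by
    intro f g
    have : symDeriv ⁅f, g⁆ = ⁅symDeriv f, symDeriv g⁆ :=
      symDerivation_ext fun a => by
        simp [symDeriv_ι, Derivation.commutator_apply, LieRing.of_associative_ring_bracket]
    ext a
    rw [LieRing.of_associative_ring_bracket (A := Module.End K (SymPow K M l))]
    simp only [LinearMap.restrict_apply, this]
    rfl

variable {L : Type*} [LieRing L] [LieAlgebra K L] [LieRingModule L M] [LieModule K L M]

instance symLieRingModule (l : ℕ) : LieRingModule L (SymPow K M l) :=
  LieRingModule.compLieHom _ ((symHom (K := K) (M := M) l).comp (LieModule.toEnd K L M))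

instance symLieModule (l : ℕ) : LieModule K L (SymPow K M l) :=
  LieModule.compLieHom _ ((symHom (K := K) (M := M) l).comp (LieModule.toEnd K L M))

theorem coe_lie_symPow (l : ℕ) (x : L) (a : SymPow K M l) :
    ((⁅x, a⁆ : SymPow K M l) : SymmetricAlgebra K M) =
      symDeriv (LieModule.toEnd K L M x) (a : SymmetricAlgebra K M) := rfl

variable (K) in
/-- The element `wˡ` of the `l`-th symmetric power. -/
def symPowElem (l : ℕ) (w : M) : SymPow K M l :=
  ⟨SymmetricAlgebra.ι K M w ^ l, Submodule.pow_mem_pow _ (LinearMap.mem_range_self _ w) l⟩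

end Symmetric

/-! ### Finite tensor products of Lie modules -/

section Tensor

attribute [local instance 100] LieRing.ofAssociativeRing

variable {K : Type*} [CommRing K] {L : Type*} [LieRing L] [LieAlgebra K L]
  {ι : Type*} [Fintype ι] [DecidableEq ι] {N : ι → Type*} [∀ i, AddCommGroup (N i)]
  [∀ i, Module K (N i)] [∀ i, LieRingModule L (N i)] [∀ i, LieModule K L (N i)]

variable (N) in
/-- `x` acts on a tensor product by `∑ i, 1 ⊗ ⋯ ⊗ x ⊗ ⋯ ⊗ 1`, with `x` in position `i`. -/
def tensorAct (x : L) : Module.End K (⨂[K] i, N i) :=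
  ∑ i, PiTensorProduct.map
    (Function.update (fun j => (LinearMap.id : N j →ₗ[K] N j)) i (LieModule.toEnd K L (N i) x))

theorem tensorAct_tprod (x : L) (a : ∀ i, N i) :
    tensorAct N x (PiTensorProduct.tprod K a) =
      ∑ i, PiTensorProduct.tprod K (Function.update a i ⁅x, a i⁆) := by
  simp only [tensorAct, LinearMap.sum_apply, PiTensorProduct.map_tprod]
  refine Finset.sum_congr rfl fun i _ => ?_
  congr 1
  funext j
  by_cases h : j = i
  · subst h; simp
  · simp [h]

variable (K L N) in
/-- The action on a tensor product as a homomorphism of Lie algebras. -/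
def tensorHom : L →ₗ⁅K⁆ Module.End K (⨂[K] i, N i) where
  toFun := tensorAct N
  map_add' x y := by
    apply PiTensorProduct.ext
    ext1 a
    simp [tensorAct_tprod, Finset.sum_add_distrib]
  map_smul' c x := by
    apply PiTensorProduct.ext
    ext1 a
    simp [tensorAct_tprod, Finset.smul_sum]
  map_lie' := by
    intro x y
    apply PiTensorProduct.ext
    ext1 a
    simp only [LinearMap.compMultilinearMap_apply, tensorAct_tprod,
      LieRing.of_associative_ring_bracket (A := Module.End K (⨂[K] i, N i)),
      LinearMap.sub_apply, Module.End.mul_apply, map_sum, lie_lie, MultilinearMap.map_update_sub,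
      Finset.sum_sub_distrib]
    have hd : ∀ x y : L, ∀ i, ∑ j, PiTensorProduct.tprod K (Function.update
        (Function.update a i ⁅y, a i⁆) j ⁅x, Function.update a i ⁅y, a i⁆ j⁆) =
        PiTensorProduct.tprod K (Function.update a i ⁅x, ⁅y, a i⁆⁆) +
          ∑ j, if j = i then 0 else PiTensorProduct.tprod K (Function.update
        (Function.update a i ⁅y, a i⁆) j ⁅x, a j⁆) := by
      intro x y i
      rw [← Finset.add_sum_erase _ _ (Finset.mem_univ i),
        ← Finset.add_sum_erase _ (fun j => if j = i then (0 : ⨂[K] i, N i) else _)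
          (Finset.mem_univ i)]
      simp only [Function.update_self, Function.update_idem, if_true, zero_add]
      congr 1
      refine Finset.sum_congr rfl fun j hj => ?_
      have hj' : j ≠ i := (Finset.mem_erase.1 hj).1
      simp [hj']
    simp only [hd, Finset.sum_add_distrib]
    have hc : (∑ i, ∑ j, if j = i then (0 : ⨂[K] i, N i) else
        PiTensorProduct.tprod K (Function.update
        (Function.update a i ⁅y, a i⁆) j ⁅x, a j⁆)) =
        ∑ i, ∑ j, if j = i then (0 : ⨂[K] i, N i) else
        PiTensorProduct.tprod K (Function.update
        (Function.update a i ⁅x, a i⁆) j ⁅y, a j⁆) := by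
      rw [Finset.sum_comm]
      refine Finset.sum_congr rfl fun i _ => Finset.sum_congr rfl fun j _ => ?_
      by_cases h : i = j
      · simp [h]
      · rw [if_neg h, if_neg (Ne.symm h), Function.update_comm (Ne.symm h)]
    rw [hc]
    abel

instance tensorLieRingModule : LieRingModule L (⨂[K] i, N i) :=
  LieRingModule.compLieHom _ (tensorHom K L N)

instance tensorLieModule : LieModule K L (⨂[K] i, N i) :=
  LieModule.compLieHom _ (tensorHom K L N)

theorem lie_tprod (x : L) (a : ∀ i, N i) :
    ⁅x, PiTensorProduct.tprod K a⁆ =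
      ∑ i, PiTensorProduct.tprod K (Function.update a i ⁅x, a i⁆) :=
  tensorAct_tprod x a

end Tensor

/-! ### The Lie algebra `sl(E)`, its triangular decomposition, and weights -/

section SLdef

attribute [local instance 100] LieRing.ofAssociativeRing

variable (K : Type*) [Field K] (E : Type*) [AddCommGroup E] [Module K E]

/-- The Lie subalgebra of `End(E)` of endomorphisms of trace zero. -/
def slSubalgebra : LieSubalgebra K (Module.End K E) where
  __ := LinearMap.ker (LinearMap.trace K E)
  lie_mem' := fun {x y} _ _ => by
    simp [LinearMap.trace_lie]

/-- The Lie algebra `sl(E)`. It is a type of its own, so that the only Lie actions of `sl(E)` are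
the natural one on `E` and those built from it. -/
def sl : Type _ := slSubalgebra K E

instance : LieRing (sl K E) := inferInstanceAs (LieRing (slSubalgebra K E))

instance : LieAlgebra K (sl K E) := inferInstanceAs (LieAlgebra K (slSubalgebra K E))

instance : LieRingModule (sl K E) E := inferInstanceAs (LieRingModule (slSubalgebra K E) E)

instance : LieModule K (sl K E) E := inferInstanceAs (LieModule K (slSubalgebra K E) E)

variable {K E}

/-- The inclusion of `sl(E)` in `End(E)`. -/
def sl.incl : sl K E →ₗ[K] Module.End K E := (slSubalgebra K E).toSubmodule.subtype

theorem sl.incl_lie (x y : sl K E) :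
    sl.incl ⁅x, y⁆ = sl.incl x * sl.incl y - sl.incl y * sl.incl x := rfl

theorem sl.lie_eq_incl (x : sl K E) (a : E) : ⁅x, a⁆ = sl.incl x a := rfl

theorem sl.trace_incl (x : sl K E) : LinearMap.trace K E (sl.incl x) = 0 := x.2

end SLdef

section SL

variable {K : Type*} [Field K] {E : Type*} [AddCommGroup E] [Module K E]
  {n : ℕ} (e : Module.Basis (Fin n) K E)

/-- `𝔥`: the elements of `sl(E)` whose matrix in the basis `e` is diagonal. -/
def diag : LieSubalgebra K (sl K E) where
  carrier := {x | ∀ i j, i ≠ j → LinearMap.toMatrix e e (sl.incl x) i j = 0}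
  add_mem' {x y} hx hy i j h := by simp [hx i j h, hy i j h]
  zero_mem' i j _ := by simp
  smul_mem' c x hx i j h := by simp [hx i j h]
  lie_mem' {x y} hx hy i j h := by
    have hz : ∀ {x y : sl K E},
        (∀ i j, i ≠ j → LinearMap.toMatrix e e (sl.incl x) i j = 0) →
        (∀ i j, i ≠ j → LinearMap.toMatrix e e (sl.incl y) i j = 0) →
        (LinearMap.toMatrix e e (sl.incl x) *
          LinearMap.toMatrix e e (sl.incl y)) i j = 0 := by
      intro x y hx hy
      rw [Matrix.mul_apply]
      refine Finset.sum_eq_zero fun k _ => ?_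
      by_cases hk : i = k
      · subst hk; rw [hy i j h, mul_zero]
      · rw [hx i k hk, zero_mul]
    rw [sl.incl_lie, map_sub,
      LinearMap.toMatrix_mul, LinearMap.toMatrix_mul, Matrix.sub_apply, hz hx hy, hz hy hx,
      sub_zero]

/-- `𝔫₊`: the elements of `sl(E)` whose matrix in the basis `e` is strictly upper triangular. -/
def nPlus : LieSubalgebra K (sl K E) where
  carrier := {x | ∀ i j, j ≤ i → LinearMap.toMatrix e e (sl.incl x) i j = 0}
  add_mem' {x y} hx hy i j h := by simp [hx i j h, hy i j h]
  zero_mem' i j _ := by simp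
  smul_mem' c x hx i j h := by simp [hx i j h]
  lie_mem' {x y} hx hy i j h := by
    have hz : ∀ {x y : sl K E},
        (∀ i j, j ≤ i → LinearMap.toMatrix e e (sl.incl x) i j = 0) →
        (∀ i j, j ≤ i → LinearMap.toMatrix e e (sl.incl y) i j = 0) →
        (LinearMap.toMatrix e e (sl.incl x) *
          LinearMap.toMatrix e e (sl.incl y)) i j = 0 := by
      intro x y hx hy
      rw [Matrix.mul_apply]
      refine Finset.sum_eq_zero fun k _ => ?_
      by_cases hk : k ≤ i
      · rw [hx i k hk, zero_mul]
      · rw [hy k j (h.trans (not_le.1 hk).le), mul_zero]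
    rw [sl.incl_lie, map_sub,
      LinearMap.toMatrix_mul, LinearMap.toMatrix_mul, Matrix.sub_apply, hz hx hy, hz hy hx,
      sub_zero]

/-- `Lᵢ ∈ 𝔥*`: the `i`-th diagonal entry. -/
def diagEntry (i : Fin n) : Module.Dual K (diag e) where
  toFun x := LinearMap.toMatrix e e (sl.incl (x : sl K E)) i i
  map_add' x y := by simp
  map_smul' c x := by simp

/-- The fundamental weight `ω_m = L₁ + ⋯ + L_m` (used for `1 ≤ m ≤ n - 1`). -/
def fundWeight (m : ℕ) : Module.Dual K (diag e) :=
  ∑ i ∈ Finset.univ.filter (fun i : Fin n => (i : ℕ) < m), diagEntry e i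

/-- `v` is a highest weight vector, of highest weight `lam ∈ 𝔥*`, for the `sl(E)`-module `V`
(with respect to the triangular decomposition given by the basis `e`): it is nonzero, it is a
weight vector of weight `lam`, it is annihilated by `𝔫₊`, and it generates `V`. -/
structure IsHighestWeightVector {V : Type*} [AddCommGroup V] [Module K V]
    [LieRingModule (sl K E) V] (v : V) (lam : Module.Dual K (diag e)) : Prop where
  ne_zero : v ≠ 0
  weight : ∀ x : diag e, ⁅(x : sl K E), v⁆ = lam x • v
  nPlus_lie : ∀ x ∈ nPlus e, ⁅x, v⁆ = 0
  generates : LieSubmodule.lieSpan K (sl K E) {v} = ⊤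

/-- `span(e₁, …, e_m)`. -/
def flagSpace (m : ℕ) : Submodule K E :=
  Submodule.span K (e '' {j | (j : ℕ) < m})

/-- The line `⋀ᵐ span(e₁, …, e_m)` inside `⋀ᵐ E`. -/
def flagLine (m : ℕ) : Submodule K (⋀[K]^m E) :=
  LinearMap.range (exteriorPower.map m (flagSpace e m).subtype)

variable (K E) in
/-- `W(l, n) = Sym^{l₁}(⋀^{n₁} E) ⊗ ⋯ ⊗ Sym^{l_k}(⋀^{n_k} E)`. -/
abbrev W {k : ℕ} (l ns : Fin k → ℕ) : Type _ :=
  ⨂[K] i, SymPow K (⋀[K]^(ns i) E) (l i)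

/-- `w₁^{l₁} ⊗ ⋯ ⊗ w_k^{l_k}`. -/
def hwVec {k : ℕ} (l ns : Fin k → ℕ) (w : ∀ i, ⋀[K]^(ns i) E) : W K E l ns :=
  PiTensorProduct.tprod K fun i => symPowElem K (l i) (w i)

/-- The `sl(E)`-submodule of `W(l, n)` generated by `w₁^{l₁} ⊗ ⋯ ⊗ w_k^{l_k}`. -/
def V {k : ℕ} (l ns : Fin k → ℕ) (w : ∀ i, ⋀[K]^(ns i) E) :
    LieSubmodule K (sl K E) (W K E l ns) :=
  LieSubmodule.lieSpan K (sl K E) {hwVec l ns w}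

/-- `w₁^{l₁} ⊗ ⋯ ⊗ w_k^{l_k}` as an element of the submodule that it generates. -/
def hwVecV {k : ℕ} (l ns : Fin k → ℕ) (w : ∀ i, ⋀[K]^(ns i) E) : V l ns w :=
  ⟨hwVec l ns w, LieSubmodule.subset_lieSpan rfl⟩

end SL

end SLHighest

end

noncomputable section

namespace SLHighest

section Criterion

variable {K : Type*} [Field K] {L : Type*} [LieRing L] [LieAlgebra K L]
  {M : Type*} [AddCommGroup M] [Module K M] [LieRingModule L M]
  {ι : Type*}

/-- `x` and `y` act in the basis `b` by rational matrices that are transposes of each other. -/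
def IsTransposePair [CharZero K] [Fintype ι] (b : Module.Basis ι K M) (x y : L) : Prop :=
  ∃ A : Matrix ι ι ℚ, (∀ q, ⁅x, b q⁆ = ∑ p, (A p q : K) • b p) ∧
    ∀ q, ⁅y, b q⁆ = ∑ p, (A q p : K) • b p

/-- The coordinates of `v` in the basis `b` are rational. -/
def IsRationalVec (b : Module.Basis ι K M) (v : M) : Prop :=
  ∀ p, ∃ r : ℚ, b.repr v p = r

/-- `h` acts diagonally in the basis `b`, with rational eigenvalues `d`. -/
def ActsDiagonally (b : Module.Basis ι K M) (h : L) (d : ι → ℚ) : Prop :=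
  ∀ p, ⁅h, b p⁆ = (d p : K) • b p

variable [LieModule K L M]

theorem lieSpan_le_of_stable {R : Set L} (hR : Submodule.span K R = ⊤) {v : M}
    {S : Submodule K M} (hv : v ∈ S) (hS : ∀ x ∈ R, ∀ s ∈ S, ⁅x, s⁆ ∈ S) :
    (LieSubmodule.lieSpan K L {v}).toSubmodule ≤ S := by
  have hall : ∀ x : L, ∀ s ∈ S, ⁅x, s⁆ ∈ S := by
    intro x
    have hx : x ∈ Submodule.span K R := hR ▸ Submodule.mem_top
    induction hx using Submodule.span_induction with
    | mem x hx => exact hS x hx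
    | zero => intro s _; simp
    | add x y _ _ hx hy => intro s hs; rw [add_lie]; exact add_mem (hx s hs) (hy s hs)
    | smul c x _ hx => intro s hs; rw [smul_lie]; exact S.smul_mem c (hx s hs)
  let N : LieSubmodule K L M := { S with lie_mem := fun {x m} hm => hall x m hm }
  exact (LieSubmodule.lieSpan_le (N := N)).2 (Set.singleton_subset_iff.2 hv)

theorem repr_lie_of_actsDiagonally [Fintype ι] {b : Module.Basis ι K M} {h : L} {d : ι → ℚ}
    (hd : ActsDiagonally b h d) (t : M) (p : ι) :
    b.repr ⁅h, t⁆ p = d p * b.repr t p := by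
  classical
  conv_lhs => rw [← b.sum_repr t]
  simp only [lie_sum, lie_smul, hd _, map_sum, map_smul, Finsupp.coe_finsetSum,
    Finset.sum_apply, Finsupp.smul_apply, b.repr_self, smul_eq_mul]
  rw [Finset.sum_eq_single p]
  · simp [mul_comm]
  · intro q _ hq; simp [hq]
  · simp

theorem IsTransposePair.toDual_lie [CharZero K] [Fintype ι] [DecidableEq ι]
    {b : Module.Basis ι K M} {x y : L} (h : IsTransposePair b x y) (s t : M) :
    b.toDual ⁅x, s⁆ t = b.toDual s ⁅y, t⁆ := by
  obtain ⟨A, hx, hy⟩ := h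
  have : b.toDual ∘ₗ LieModule.toEnd K L M x =
      (LinearMap.lcomp K K (LieModule.toEnd K L M y)) ∘ₗ b.toDual := by
    refine b.ext fun p => b.ext fun q => ?_
    simp [hx, hy, Module.Basis.toDual_apply]
  exact LinearMap.congr_fun (LinearMap.congr_fun this s) t

theorem IsTransposePair.isRationalVec_lie [CharZero K] [Fintype ι]
    {b : Module.Basis ι K M} {x y : L} (h : IsTransposePair b x y) {s : M}
    (hs : IsRationalVec b s) : IsRationalVec b ⁅x, s⁆ := by
  classical
  obtain ⟨A, hx, -⟩ := h
  choose r hr using hs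
  intro p
  refine ⟨∑ q, r q * A p q, ?_⟩
  conv_lhs => rw [← b.sum_repr s]
  simp only [lie_sum, lie_smul, hx, map_sum, map_smul, Finsupp.coe_finsetSum,
    Finset.sum_apply, Finsupp.smul_apply, b.repr_self, smul_eq_mul, hr]
  push_cast
  refine Finset.sum_congr rfl fun q _ => ?_
  congr 1
  rw [Finset.sum_eq_single p]
  · simp
  · intro q _ hq; simp [hq]
  · simp


/-- The `K`-span of rational vectors lying in a subspace `S` meets the orthogonal complement of `S`
trivially. -/
theorem eq_zero_of_mem_span_rational [CharZero K] [Fintype ι] [DecidableEq ι]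
    (b : Module.Basis ι K M) {S : Submodule K M} {u : M}
    (hu : u ∈ Submodule.span K {s | s ∈ S ∧ IsRationalVec b s})
    (hS : ∀ s ∈ S, b.toDual s u = 0) : u = 0 := by
  have key : ∀ φ : K →ₗ[ℚ] ℚ, ∑ p, ((φ (b.repr u p) : ℚ) : K) • b p ∈ S := by
    clear hS
    induction hu using Submodule.span_induction with
    | mem s hs =>
      intro φ
      choose r hr using hs.2
      have : ∑ p, ((φ (b.repr s p) : ℚ) : K) • b p = ((φ 1 : ℚ) : K) • s := by
        conv_rhs => rw [← b.sum_repr s, Finset.smul_sum]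
        refine Finset.sum_congr rfl fun p _ => ?_
        rw [smul_smul, hr p, show ((r p : ℚ) : K) = r p • (1 : K) by simp [Rat.smul_def],
          map_smul, smul_eq_mul, Rat.smul_def]
        push_cast
        rw [mul_one, mul_comm]
      rw [this]
      exact S.smul_mem _ hs.1
    | zero => intro φ; simp
    | add x y _ _ hx hy =>
      intro φ
      simp only [map_add, Finsupp.add_apply, Rat.cast_add, add_smul, Finset.sum_add_distrib]
      exact add_mem (hx φ) (hy φ)
    | smul c x _ hx =>
      intro φ
      have := hx (φ ∘ₗ LinearMap.mulLeft ℚ c)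
      simpa using this
  have hzero : ∀ p, b.repr u p = 0 := by
    intro p
    rw [← Module.forall_dual_apply_eq_zero_iff ℚ]
    intro φ
    have h1 := hS _ (key φ)
    have h2 : b.toDual (∑ q, ((φ (b.repr u q) : ℚ) : K) • b q) u =
        ∑ q, (φ (b.repr u q)) • b.repr u q := by
      simp [Module.Basis.toDual_apply_right, Rat.smul_def]
    rw [h2] at h1
    have h3 := congrArg φ h1
    simp only [map_sum, map_smul, smul_eq_mul, map_zero] at h3
    rw [Finset.sum_eq_zero_iff_of_nonneg fun q _ => mul_self_nonneg _] at h3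
    exact mul_self_eq_zero.1 (h3 p (Finset.mem_univ p))
  exact b.repr.map_eq_zero_iff.1 (Finsupp.ext hzero)

theorem lieSpan_le_lowering {R : Set L} (hR : Submodule.span K R = ⊤) {v : M} {N : Set L}
    (hx : ∀ x ∈ R, ⁅x, v⁆ ∈ Submodule.span K {v} ∨ x ∈ N) {S : Submodule K M} (hv : v ∈ S)
    (hS : ∀ x ∈ N, ∀ s ∈ S, ⁅x, s⁆ ∈ S) :
    (LieSubmodule.lieSpan K L {v}).toSubmodule ≤ S := by
  let Z : Submodule K M := sInf {S | v ∈ S ∧ ∀ x ∈ N, ∀ s ∈ S, ⁅x, s⁆ ∈ S}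
  have hvZ : v ∈ Z := by
    rw [Submodule.mem_sInf]
    exact fun T hT => hT.1
  have hZN : ∀ x ∈ N, ∀ z ∈ Z, ⁅x, z⁆ ∈ Z := by
    intro x hxN z hz
    rw [Submodule.mem_sInf] at hz ⊢
    exact fun T hT => hT.2 x hxN z (hz T hT)
  let Z' : Submodule K M :=
    { carrier := {z | z ∈ Z ∧ ∀ x : L, ⁅x, z⁆ ∈ Z}
      add_mem' := fun ha hb => ⟨add_mem ha.1 hb.1, fun x => by
        rw [lie_add]; exact add_mem (ha.2 x) (hb.2 x)⟩
      zero_mem' := ⟨zero_mem _, fun x => by simp⟩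
      smul_mem' := fun c z hz => ⟨Z.smul_mem c hz.1, fun x => by
        rw [lie_smul]; exact Z.smul_mem c (hz.2 x)⟩ }
  have hvx : ∀ x : L, ⁅x, v⁆ ∈ Z := by
    intro x
    have hxR : x ∈ Submodule.span K R := hR ▸ Submodule.mem_top
    induction hxR using Submodule.span_induction with
    | mem x h =>
      rcases hx x h with h | h
      · exact (Submodule.span_singleton_le_iff_mem _ _).2 hvZ h
      · exact hZN x h v hvZ
    | zero => simp
    | add x y _ _ hx hy => rw [add_lie]; exact add_mem hx hy
    | smul c x _ hx => rw [smul_lie]; exact Z.smul_mem c hx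
  have hZZ' : Z ≤ Z' := by
    refine sInf_le ⟨⟨hvZ, hvx⟩, fun y hy z hz => ⟨hZN y hy z hz.1, fun x => ?_⟩⟩
    rw [leibniz_lie]
    exact add_mem (hz.2 _) (hZN y hy _ (hz.2 x))
  exact (lieSpan_le_of_stable hR hvZ fun x _ s hs => (hZZ' hs).2 x).trans (sInf_le ⟨hv, hS⟩)

/-- If `U` contains a vector with nonzero component along the eigenvector `v` and all other
components in eigenspaces of strictly smaller eigenvalue, then `U` contains `v`. -/
theorem mem_of_smul_add_mem [CharZero K] [Fintype ι] {b : Module.Basis ι K M} {h : L}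
    {d : ι → ℚ} (hd : ActsDiagonally b h d) {v : M} {μ : ℚ} (hμ : ⁅h, v⁆ = (μ : K) • v)
    (U : LieSubmodule K L M) (s : Finset ι) (hs : ∀ p ∈ s, d p < μ) {c : K} (hc : c ≠ 0) {t : M}
    (ht : ∀ p ∉ s, b.repr t p = 0) (hu : c • v + t ∈ U) : v ∈ U := by
  classical
  induction s using Finset.induction_on generalizing c t with
  | empty =>
    have : t = 0 := b.repr.map_eq_zero_iff.1 (Finsupp.ext fun p => ht p (by simp))
    rw [this, add_zero] at hu
    have := U.smul_mem c⁻¹ hu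
    rwa [smul_smul, inv_mul_cancel₀ hc, one_smul] at this
  | insert p s hp ih =>
    have hlt : d p < μ := hs p (Finset.mem_insert_self p s)
    have hmem : ((μ - d p : K) * c) • v + (⁅h, t⁆ - (d p : K) • t) ∈ U := by
      have := sub_mem (U.lie_mem (x := h) hu) (U.smul_mem (d p : K) hu)
      have heq : ⁅h, c • v + t⁆ - (d p : K) • (c • v + t) =
          ((μ - d p : K) * c) • v + (⁅h, t⁆ - (d p : K) • t) := by
        rw [lie_add, lie_smul, hμ]
        module
      rwa [heq] at this
    refine ih (fun q hq => hs q (Finset.mem_insert_of_mem hq)) (mul_ne_zero ?_ hc) ?_ hmem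
    · rw [sub_ne_zero]
      exact_mod_cast hlt.ne'
    · intro q hq
      simp only [map_sub, map_smul, Finsupp.sub_apply, Finsupp.smul_apply, smul_eq_mul,
        repr_lie_of_actsDiagonally hd]
      by_cases hqp : q = p
      · subst hqp; ring
      · rw [ht q (by simp [hq, hqp])]; ring

/-- Irreducibility criterion for a cyclic module generated by a rational highest weight vector,
on which the Lie algebra acts by rational matrices and their transposes. -/
theorem eq_bot_or_mem_of_le_lieSpan [CharZero K] [Fintype ι] (b : Module.Basis ι K M) {R : Set L}
    (hR : Submodule.span K R = ⊤) (hpair : ∀ x ∈ R, ∃ y, IsTransposePair b x y)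
    {h : L} {d : ι → ℚ} (hd : ActsDiagonally b h d) {v : M} (hv : IsRationalVec b v)
    {μ : ℚ} (hμ : ⁅h, v⁆ = (μ : K) • v)
    (hx : ∀ x ∈ R, ⁅x, v⁆ ∈ Submodule.span K {v} ∨ ∃ δ : ℚ, 0 < δ ∧ ⁅h, x⁆ = -(δ : K) • x)
    (U : LieSubmodule K L M) (hU : U ≤ LieSubmodule.lieSpan K L {v}) : U = ⊥ ∨ v ∈ U := by
  classical
  let T : Submodule K M :=
    { carrier := {t | ∀ p, μ ≤ d p → b.repr t p = 0}
      add_mem' := fun ha hb p hp => by simp [ha p hp, hb p hp]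
      zero_mem' := fun p _ => by simp
      smul_mem' := fun c t ht p hp => by simp [ht p hp] }
  have heig : ∀ {w : M} {c : ℚ}, ⁅h, w⁆ = (c : K) • w → ∀ p, d p ≠ c → b.repr w p = 0 := by
    intro w c hw p hp
    have h1 := repr_lie_of_actsDiagonally hd w p
    rw [hw, map_smul, Finsupp.smul_apply, smul_eq_mul] at h1
    have h2 : ((d p : K) - c) * b.repr w p = 0 := by rw [sub_mul, ← h1, sub_self]
    refine (mul_eq_zero.1 h2).resolve_left ?_
    rw [sub_eq_zero]
    exact_mod_cast hp
  have hlow : ∀ {w : M} {c δ : ℚ} {x : L}, ⁅h, w⁆ = (c : K) • w → c ≤ μ → 0 < δ →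
      ⁅h, x⁆ = -(δ : K) • x → ⁅x, w⁆ ∈ T := by
    intro w c δ x hw hc hδ hx p hp
    refine heig (c := c - δ) ?_ p (by linarith : c - δ < d p).ne'
    rw [leibniz_lie, hx, hw, lie_smul, smul_lie]
    push_cast
    module
  have hspan : (LieSubmodule.lieSpan K L {v}).toSubmodule ≤ Submodule.span K {v} ⊔ T := by
    refine lieSpan_le_lowering hR (N := {x | ∃ δ : ℚ, 0 < δ ∧ ⁅h, x⁆ = -(δ : K) • x}) hx
      (Submodule.mem_sup_left (Submodule.mem_span_singleton_self v)) ?_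
    rintro x ⟨δ, hδ, hxδ⟩ s hs
    refine Submodule.mem_sup_right ?_
    obtain ⟨s₁, hs₁, s₂, hs₂, rfl⟩ := Submodule.mem_sup.1 hs
    obtain ⟨c, rfl⟩ := Submodule.mem_span_singleton.1 hs₁
    rw [lie_add, lie_smul]
    refine add_mem (T.smul_mem c (hlow hμ le_rfl hδ hxδ)) ?_
    rw [← b.sum_repr s₂, lie_sum]
    refine sum_mem fun p _ => ?_
    rw [lie_smul]
    by_cases hp : μ ≤ d p
    · rw [hs₂ p hp, zero_smul]; exact zero_mem _
    · exact T.smul_mem _ (hlow (hd p) (not_le.1 hp).le hδ hxδ)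
  by_cases hUT : U.toSubmodule ≤ T
  · left
    have horth : ∀ s ∈ LieSubmodule.lieSpan K L {v}, ∀ u ∈ U, b.toDual s u = 0 := by
      let S : Submodule K M :=
        { carrier := {s | ∀ u ∈ U, b.toDual s u = 0}
          add_mem' := fun ha hb u hu => by simp [ha u hu, hb u hu]
          zero_mem' := fun u _ => by simp
          smul_mem' := fun c s hs u hu => by simp [hs u hu] }
      refine lieSpan_le_of_stable (S := S) hR ?_ ?_
      · intro u hu
        have : b.toDual v u = ∑ p, b.repr v p * b.repr u p := by
          conv_lhs => rw [← b.sum_repr v]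
          rw [map_sum, LinearMap.sum_apply]
          simp only [map_smul, LinearMap.smul_apply, smul_eq_mul, Module.Basis.toDual_apply_right]
        rw [this]
        refine Finset.sum_eq_zero fun p _ => ?_
        by_cases hp : d p = μ
        · rw [hUT hu p hp.ge, mul_zero]
        · rw [heig hμ p hp, zero_mul]
      · intro x hxR s hs u hu
        obtain ⟨y, hy⟩ := hpair x hxR
        rw [hy.toDual_lie]
        exact hs _ (U.lie_mem hu)
    have hrat : (LieSubmodule.lieSpan K L {v}).toSubmodule ≤
        Submodule.span K {s | s ∈ (LieSubmodule.lieSpan K L {v}).toSubmodule ∧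
          IsRationalVec b s} := by
      refine lieSpan_le_of_stable hR
        (Submodule.subset_span ⟨LieSubmodule.subset_lieSpan rfl, hv⟩) ?_
      intro x hxR s hs
      obtain ⟨y, hy⟩ := hpair x hxR
      induction hs using Submodule.span_induction with
      | mem s hs =>
        exact Submodule.subset_span ⟨LieSubmodule.lie_mem _ hs.1, hy.isRationalVec_lie hs.2⟩
      | zero => simp
      | add s t _ _ hs ht => rw [lie_add]; exact add_mem hs ht
      | smul c s _ hs => rw [lie_smul]; exact Submodule.smul_mem _ c hs
    rw [LieSubmodule.eq_bot_iff]
    intro u hu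
    exact eq_zero_of_mem_span_rational b (hrat (hU hu)) fun s hs => horth s hs u hu
  · right
    obtain ⟨u, hu, huT⟩ := Set.not_subset.1 hUT
    obtain ⟨s, hs, t, ht, rfl⟩ := Submodule.mem_sup.1 (hspan (hU hu))
    obtain ⟨c, rfl⟩ := Submodule.mem_span_singleton.1 hs
    refine mem_of_smul_add_mem hd hμ U (Finset.univ.filter fun p => d p < μ) (by simp) ?_
      (fun p hp => ht p (by simpa using hp)) hu
    rintro rfl
    exact huT (by simpa using ht)

end Criterion

section TensorBasis

variable {K : Type*} [Field K] [CharZero K] {L : Type*} [LieRing L] [LieAlgebra K L]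
  {ι : Type*} [Fintype ι] [DecidableEq ι] {N : ι → Type*} [∀ i, AddCommGroup (N i)]
  [∀ i, Module K (N i)] [∀ i, LieRingModule L (N i)] [∀ i, LieModule K L (N i)]
  {κ : ι → Type*} [∀ i, Fintype (κ i)] {b : ∀ i, Module.Basis (κ i) K (N i)}

theorem lie_piTensorProduct_apply [∀ i, DecidableEq (κ i)] {x : L}
    {A : ∀ i, Matrix (κ i) (κ i) ℚ}
    (hx : ∀ i q, ⁅x, b i q⁆ = ∑ p, (A i p q : K) • b i p) (g : ∀ i, κ i) :
    ⁅x, Basis.piTensorProduct b g⁆ = ∑ f, ((∑ i, ∏ j,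
      Function.update (fun j => (1 : Matrix (κ j) (κ j) ℚ)) i (A i) j (f j) (g j) : ℚ) : K) •
        Basis.piTensorProduct b f := by
  simp only [Basis.piTensorProduct_apply, lie_tprod, Rat.cast_sum, Finset.sum_smul]
  rw [Finset.sum_comm]
  refine Finset.sum_congr rfl fun i _ => ?_
  have : Function.update (fun j => b j (g j)) i ⁅x, b i (g i)⁆ = fun j => ∑ p, ((Function.update
      (fun j => (1 : Matrix (κ j) (κ j) ℚ)) i (A i) j p (g j) : ℚ) : K) • b j p := by
    funext j
    by_cases h : j = i
    · subst h; simp [hx]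
    · simp [h, Matrix.one_apply, apply_ite (Rat.cast : ℚ → K)]
  rw [this, MultilinearMap.map_sum]
  refine Finset.sum_congr rfl fun f _ => ?_
  rw [MultilinearMap.map_smul_univ, Rat.cast_prod]

theorem IsTransposePair.piTensorProduct {x y : L} (h : ∀ i, IsTransposePair (b i) x y) :
    IsTransposePair (Basis.piTensorProduct b) x y := by
  classical
  choose A hx hy using h
  refine ⟨Matrix.of fun f g => ∑ i, ∏ j,
    Function.update (fun j => (1 : Matrix (κ j) (κ j) ℚ)) i (A i) j (f j) (g j),
    lie_piTensorProduct_apply hx, fun g => ?_⟩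
  rw [lie_piTensorProduct_apply (A := fun i => (A i).transpose) hy]
  refine Finset.sum_congr rfl fun f _ => ?_
  congr 2
  refine Finset.sum_congr rfl fun i _ => Finset.prod_congr rfl fun j _ => ?_
  by_cases h : j = i
  · subst h; simp
  · simp [h, Matrix.one_apply, eq_comm]

omit [DecidableEq ι] [∀ i, Fintype (κ i)] in
theorem IsRationalVec.tprod {a : ∀ i, N i} (h : ∀ i, IsRationalVec (b i) (a i)) :
    IsRationalVec (Basis.piTensorProduct b) (PiTensorProduct.tprod K a) := by
  choose r hr using h
  exact fun f => ⟨∏ i, r i (f i), by simp [hr]⟩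

omit [∀ i, Fintype (κ i)] in
theorem ActsDiagonally.piTensorProduct {h : L} {d : ∀ i, κ i → ℚ}
    (hd : ∀ i, ActsDiagonally (b i) h (d i)) :
    ActsDiagonally (Basis.piTensorProduct b) h fun f => ∑ i, d i (f i) := by
  intro f
  have : ∀ i, Function.update (fun j => b j (f j)) i ((d i (f i) : K) • b i (f i)) =
      Function.update (fun j => b j (f j)) i
        ((d i (f i) : K) • (fun j => b j (f j)) i) := fun _ => rfl
  simp only [Basis.piTensorProduct_apply, lie_tprod, hd _ _, MultilinearMap.map_update_smul,
    Function.update_eq_self, Rat.cast_sum, Finset.sum_smul]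

theorem tprod_ne_zero {F : Type*} [Field F] {ι : Type*} [Fintype ι] {N : ι → Type*}
    [∀ i, AddCommGroup (N i)] [∀ i, Module F (N i)] {a : ∀ i, N i} (ha : ∀ i, a i ≠ 0) :
    PiTensorProduct.tprod F a ≠ 0 := by
  intro h
  have : ∀ i, ∃ φ : N i →ₗ[F] F, φ (a i) ≠ 0 := fun i => by
    by_contra! hc
    exact ha i ((Module.forall_dual_apply_eq_zero_iff F _).1 hc)
  choose φ hφ using this
  have h1 := congrArg (PiTensorProduct.lift
    ((MultilinearMap.mkPiAlgebra F ι F).compLinearMap φ)) h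
  rw [PiTensorProduct.lift.tprod, map_zero] at h1
  simp [Finset.prod_eq_zero_iff, hφ] at h1

theorem lie_tprod_of_eigen {F : Type*} [CommRing F] {L : Type*} [LieRing L] [LieAlgebra F L]
    {ι : Type*} [Fintype ι] [DecidableEq ι] {N : ι → Type*} [∀ i, AddCommGroup (N i)]
    [∀ i, Module F (N i)] [∀ i, LieRingModule L (N i)] [∀ i, LieModule F L (N i)]
    {x : L} {a : ∀ i, N i} {c : ι → F} (h : ∀ i, ⁅x, a i⁆ = c i • a i) :
    ⁅x, PiTensorProduct.tprod F a⁆ = (∑ i, c i) • PiTensorProduct.tprod F a := by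
  simp only [lie_tprod, h, MultilinearMap.map_update_smul, Function.update_eq_self,
    Finset.sum_smul]

end TensorBasis

section TensorHom

variable {K : Type*} [CommRing K] {L : Type*} [LieRing L] [LieAlgebra K L]
  {ι : Type*} [Fintype ι] [DecidableEq ι] {N N' : ι → Type*}
  [∀ i, AddCommGroup (N i)] [∀ i, Module K (N i)] [∀ i, LieRingModule L (N i)]
  [∀ i, LieModule K L (N i)]
  [∀ i, AddCommGroup (N' i)] [∀ i, Module K (N' i)] [∀ i, LieRingModule L (N' i)]
  [∀ i, LieModule K L (N' i)] {P : Type*} [AddCommGroup P] [Module K P] [LieRingModule L P]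
  [LieModule K L P]

/-- The homomorphism of Lie modules on a tensor product given by a multilinear map that
satisfies the Leibniz rule. -/
def tensorLift (f : MultilinearMap K N P)
    (hf : ∀ (x : L) (a : ∀ i, N i), ⁅x, f a⁆ = ∑ i, f (Function.update a i ⁅x, a i⁆)) :
    (⨂[K] i, N i) →ₗ⁅K, L⁆ P where
  __ := PiTensorProduct.lift f
  map_lie' := by
    intro x t
    have : PiTensorProduct.lift f ∘ₗ LieModule.toEnd K L (⨂[K] i, N i) x =
        LieModule.toEnd K L P x ∘ₗ PiTensorProduct.lift f := by
      apply PiTensorProduct.ext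
      ext a
      simp [lie_tprod, hf]
    exact LinearMap.congr_fun this t

@[simp]
theorem tensorLift_tprod (f : MultilinearMap K N P)
    (hf : ∀ (x : L) (a : ∀ i, N i), ⁅x, f a⁆ = ∑ i, f (Function.update a i ⁅x, a i⁆))
    (a : ∀ i, N i) : tensorLift f hf (PiTensorProduct.tprod K a) = f a :=
  PiTensorProduct.lift.tprod a

/-- The tensor product of homomorphisms of Lie modules. -/
def tensorMap (f : ∀ i, N i →ₗ⁅K, L⁆ N' i) : (⨂[K] i, N i) →ₗ⁅K, L⁆ ⨂[K] i, N' i :=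
  tensorLift ((PiTensorProduct.tprod K).compLinearMap fun i => (f i : N i →ₗ[K] N' i)) (by
    intro x a
    simp only [MultilinearMap.compLinearMap_apply, lie_tprod]
    refine Finset.sum_congr rfl fun i _ => ?_
    congr 1
    funext j
    by_cases h : j = i
    · subst h; simp
    · simp [h])

@[simp]
theorem tensorMap_tprod (f : ∀ i, N i →ₗ⁅K, L⁆ N' i) (a : ∀ i, N i) :
    tensorMap f (PiTensorProduct.tprod K a) = PiTensorProduct.tprod K fun i => f i (a i) :=
  tensorLift_tprod _ _ a

variable {M : Type*} [AddCommGroup M] [Module K M] [LieRingModule L M] [LieModule K L M]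

variable (K L M) in
/-- The projection from the tensor power to the exterior power. -/
def tensorToExterior (m : ℕ) : (⨂[K] _ : Fin m, M) →ₗ⁅K, L⁆ ⋀[K]^m M :=
  tensorLift (exteriorPower.ιMulti K m (M := M)).toMultilinearMap fun x a => lie_ιMulti m x a

theorem prod_ι_mem_symPow (l : ℕ) (a : Fin l → M) :
    ∏ i, SymmetricAlgebra.ι K M (a i) ∈ SymPow K M l := by
  induction l with
  | zero => simp [SymPow]
  | succ l ih =>
    rw [Fin.prod_univ_succ, SymPow, pow_succ']
    exact Submodule.mul_mem_mul (LinearMap.mem_range_self _ _) (ih _)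

theorem symDeriv_prod_ι {ι : Type*} [DecidableEq ι] (s : Finset ι) (f : Module.End K M)
    (a : ι → M) : symDeriv f (∏ i ∈ s, SymmetricAlgebra.ι K M (a i)) =
      ∑ i ∈ s, ∏ j ∈ s, SymmetricAlgebra.ι K M (Function.update a i (f (a i)) j) := by
  induction s using Finset.induction_on with
  | empty => simp
  | insert p s hp ih =>
    rw [Finset.prod_insert hp, Derivation.leibniz, ih, symDeriv_ι, Finset.sum_insert hp,
      Finset.prod_insert hp, Function.update_self, add_comm, smul_eq_mul, smul_eq_mul,
      Finset.mul_sum]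
    congr 1
    · rw [mul_comm]
      congr 1
      refine Finset.prod_congr rfl fun j hj => ?_
      rw [Function.update_of_ne (ne_of_mem_of_not_mem hj hp)]
    · refine Finset.sum_congr rfl fun i hi => ?_
      rw [Finset.prod_insert hp, Function.update_of_ne (ne_of_mem_of_not_mem hi hp).symm]

variable (K L M) in
/-- The projection from the tensor power to the symmetric power. -/
def tensorToSymPow (l : ℕ) : (⨂[K] _ : Fin l, M) →ₗ⁅K, L⁆ SymPow K M l :=
  tensorLift (((MultilinearMap.mkPiAlgebra K (Fin l) (SymmetricAlgebra K M)).compLinearMap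
      fun _ => SymmetricAlgebra.ι K M).codRestrict (SymPow K M l)
        fun a => by simpa using prod_ι_mem_symPow l a) (by
    intro x a
    apply Subtype.ext
    rw [coe_lie_symPow]
    simpa using symDeriv_prod_ι Finset.univ (LieModule.toEnd K L M x) a)

theorem tensorToSymPow_tprod_const (l : ℕ) (w : M) :
    tensorToSymPow K L M l (PiTensorProduct.tprod K fun _ => w) = symPowElem K l w := by
  apply Subtype.ext
  simp [tensorToSymPow, symPowElem]

theorem symPowElem_smul (l : ℕ) (c : K) (w : M) :
    symPowElem K l (c • w) = c ^ l • symPowElem K l w := by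
  apply Subtype.ext
  simp [symPowElem, smul_pow]

theorem symPowElem_ne_zero {F : Type*} [Field F] {M : Type*} [AddCommGroup M] [Module F M]
    (l : ℕ) {w : M} (hw : w ≠ 0) : symPowElem F l w ≠ 0 := by
  intro h
  obtain ⟨φ, hφ⟩ : ∃ φ : M →ₗ[F] F, φ w ≠ 0 := by
    by_contra! hc
    exact hw ((Module.forall_dual_apply_eq_zero_iff F _).1 hc)
  have h1 : SymmetricAlgebra.ι F M w ^ l = 0 := congrArg Subtype.val h
  have h2 := congrArg (SymmetricAlgebra.lift φ) h1
  simp only [map_pow, SymmetricAlgebra.lift_ι_apply, map_zero] at h2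
  exact pow_ne_zero l hφ h2

variable (K M) in
/-- The antisymmetrization of `a₁ ⊗ ⋯ ⊗ aₘ`, as an alternating map. -/
def altTensor (m : ℕ) : M [⋀^Fin m]→ₗ[K] ⨂[K] _ : Fin m, M :=
  MultilinearMap.alternatization (PiTensorProduct.tprod K)

theorem lie_altTensor (m : ℕ) (x : L) (a : Fin m → M) :
    ⁅x, altTensor K M m a⁆ = ∑ i, altTensor K M m (Function.update a i ⁅x, a i⁆) := by
  simp only [altTensor, MultilinearMap.alternatization_apply, lie_sum, Units.smul_def, lie_zsmul]
  rw [Finset.sum_comm]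
  refine Finset.sum_congr rfl fun σ _ => ?_
  have key : ⁅x, (PiTensorProduct.tprod K (s := fun _ : Fin m => M)).domDomCongr σ a⁆ = ∑ i,
      (PiTensorProduct.tprod K (s := fun _ : Fin m => M)).domDomCongr σ
        (Function.update a i ⁅x, a i⁆) := by
    simp only [MultilinearMap.domDomCongr_apply, lie_tprod]
    conv_rhs => rw [← Equiv.sum_comp σ]
    refine Finset.sum_congr rfl fun i _ => ?_
    congr 1
    funext j
    by_cases h : j = i
    · subst h; simp
    · simp [h]
  rw [key]
  rcases Int.units_eq_one_or (Equiv.Perm.sign σ) with h | h <;> simp [h]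

theorem tensorToExterior_altTensor (m : ℕ) (a : Fin m → M) :
    tensorToExterior K L M m (altTensor K M m a) =
      m.factorial • exteriorPower.ιMulti K m a := by
  have h := LinearMap.compMultilinearMap_alternatization
    (PiTensorProduct.lift (exteriorPower.ιMulti K m (M := M)).toMultilinearMap)
    (PiTensorProduct.tprod K (s := fun _ : Fin m => M))
  have hlift : (PiTensorProduct.lift (exteriorPower.ιMulti K m (M := M)).toMultilinearMap
      ).compMultilinearMap (PiTensorProduct.tprod K (s := fun _ : Fin m => M)) =
      (exteriorPower.ιMulti K m (M := M)).toMultilinearMap := by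
    ext1 a
    simp
  rw [hlift, AlternatingMap.coe_alternatization, Fintype.card_fin] at h
  exact (DFunLike.congr_fun h a).symm

theorem isRationalVec_altTensor {K : Type*} [Field K] [CharZero K] {M : Type*} [AddCommGroup M]
    [Module K M] {κ : Type*} {b : Module.Basis κ K M} {m : ℕ} {a : Fin m → M}
    (h : ∀ i, IsRationalVec b (a i)) :
    IsRationalVec (Basis.piTensorProduct fun _ : Fin m => b) (altTensor K M m a) := by
  choose r hr using h
  intro f
  refine ⟨∑ σ : Equiv.Perm (Fin m), (Equiv.Perm.sign σ : ℤ) * ∏ i, r (σ i) (f i), ?_⟩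
  simp [altTensor, MultilinearMap.alternatization_apply, Units.smul_def, hr]

end TensorHom

section SLaction

variable {K : Type*} [Field K] {E : Type*} [AddCommGroup E] [Module K E]
  {n : ℕ} (e : Module.Basis (Fin n) K E)

/-- The element of `sl(E)` with a given matrix of trace zero. -/
def slOfMatrix (A : Matrix (Fin n) (Fin n) K) (hA : A.trace = 0) : sl K E :=
  ⟨Matrix.toLin e e A, by
    change LinearMap.trace K E _ = 0
    rw [LinearMap.trace_eq_matrix_trace K e, LinearMap.toMatrix_toLin, hA]⟩

theorem incl_slOfMatrix (A : Matrix (Fin n) (Fin n) K) (hA : A.trace = 0) :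
    sl.incl (slOfMatrix e A hA) = Matrix.toLin e e A := rfl

theorem incl_injective : Function.Injective (sl.incl : sl K E → Module.End K E) :=
  Subtype.val_injective

theorem lie_basis (x : sl K E) (q : Fin n) :
    ⁅x, e q⁆ = ∑ p, LinearMap.toMatrix e e (sl.incl x) p q • e p := by
  rw [sl.lie_eq_incl]
  conv_lhs => rw [← Matrix.toLin_toMatrix e e (sl.incl x), Matrix.toLin_self]

theorem sl_ext {x y : sl K E}
    (h : LinearMap.toMatrix e e (sl.incl x) = LinearMap.toMatrix e e (sl.incl y)) : x = y :=
  incl_injective ((LinearMap.toMatrix e e).injective h)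

/-- The matrix unit at `(i, j)`, corrected at `(i₀, i₀)` to have trace zero. -/
def unitMatrix (R : Type*) [Ring R] (i₀ i j : Fin n) : Matrix (Fin n) (Fin n) R :=
  Matrix.single i j 1 - if i = j then Matrix.single i₀ i₀ 1 else 0

theorem trace_unitMatrix (R : Type*) [Ring R] (i₀ i j : Fin n) :
    (unitMatrix R i₀ i j).trace = 0 := by
  by_cases h : i = j
  · subst h; simp [unitMatrix]
  · simp [unitMatrix, h]

/-- The generators `Eᵢⱼ` (for `i ≠ j`) and `Eᵢᵢ - E_{i₀i₀}` of `sl(E)`. -/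
def slUnit (i₀ i j : Fin n) : sl K E := slOfMatrix e (unitMatrix K i₀ i j) (trace_unitMatrix K i₀ i j)

theorem toMatrix_slUnit (i₀ i j : Fin n) :
    LinearMap.toMatrix e e (sl.incl (slUnit e i₀ i j)) = unitMatrix K i₀ i j := by
  rw [slUnit, incl_slOfMatrix, LinearMap.toMatrix_toLin]

theorem span_slUnit :
    Submodule.span K {x : sl K E | ∃ i₀ i j, x = slUnit e i₀ i j} = ⊤ := by
  refine eq_top_iff.2 fun x _ => ?_
  rcases Nat.eq_zero_or_pos n with hn | hn
  · subst hn
    have : x = 0 := sl_ext e (by ext i; exact i.elim0)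
    rw [this]; exact zero_mem _
  · let i₀ : Fin n := ⟨0, hn⟩
    let A := LinearMap.toMatrix e e (sl.incl x)
    have hA : A.trace = 0 := by
      rw [← LinearMap.trace_eq_matrix_trace K e, sl.trace_incl]
    have hx : x = ∑ i, ∑ j, A i j • slUnit e i₀ i j := by
      apply sl_ext e
      simp only [map_sum, map_smul, toMatrix_slUnit, unitMatrix, smul_sub, Finset.sum_sub_distrib]
      have h1 : ∑ i, ∑ j, A i j • (if i = j then Matrix.single i₀ i₀ (1 : K) else 0) = 0 := by
        simp only [smul_ite, smul_zero, Finset.sum_ite_eq, Finset.mem_univ, if_true,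
          ← Finset.sum_smul]
        change A.trace • _ = _
        rw [hA, zero_smul]
      rw [h1, sub_zero]
      simpa [Matrix.smul_single] using Matrix.matrix_eq_sum_single A
    rw [hx]
    exact sum_mem fun i _ => sum_mem fun j _ =>
      Submodule.smul_mem _ _ (Submodule.subset_span ⟨i₀, i, j, rfl⟩)

theorem isTransposePair_slUnit [CharZero K] (i₀ i j : Fin n) :
    IsTransposePair e (slUnit e i₀ i j) (slUnit e i₀ j i) := by
  have hcast : ∀ i j p q, ((unitMatrix ℚ i₀ i j p q : ℚ) : K) = unitMatrix K i₀ i j p q := by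
    intro i j p q
    simp only [unitMatrix, Matrix.sub_apply, Matrix.single_apply]
    split_ifs <;> simp [Matrix.single_apply] <;> split_ifs <;> simp
  refine ⟨unitMatrix ℚ i₀ i j, fun q => ?_, fun q => ?_⟩
  · simp only [lie_basis, toMatrix_slUnit, hcast]
  · simp only [lie_basis, toMatrix_slUnit, hcast]
    refine Finset.sum_congr rfl fun p _ => ?_
    congr 1
    by_cases h : i = j
    · subst h
      simp [unitMatrix, Matrix.single_apply, and_comm]
    · simp [unitMatrix, Matrix.single_apply, h, Ne.symm h, and_comm]

/-- The diagonal entries of a regular dominant element of the Cartan subalgebra. -/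
def regularEntry (n : ℕ) (i : Fin n) : ℚ := ∑ j : Fin n, (j : ℚ) - n * i

/-- A regular dominant element of the Cartan subalgebra. -/
def slRegular [CharZero K] : sl K E :=
  slOfMatrix e (Matrix.diagonal fun i => (regularEntry n i : K)) (by
    simp [Matrix.trace_diagonal, regularEntry, Finset.mul_sum])

theorem toMatrix_slRegular [CharZero K] : LinearMap.toMatrix e e (sl.incl (slRegular e)) =
    Matrix.diagonal fun i => (regularEntry n i : K) := by
  rw [slRegular, incl_slOfMatrix, LinearMap.toMatrix_toLin]

theorem actsDiagonally_slRegular [CharZero K] :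
    ActsDiagonally e (slRegular e) (regularEntry n) := by
  intro p
  rw [lie_basis, toMatrix_slRegular, Finset.sum_eq_single p]
  · simp
  · intro q _ hq; simp [hq]
  · simp

theorem slRegular_lie_slUnit [CharZero K] {i j : Fin n} (i₀ : Fin n) (hij : i ≠ j) :
    ⁅slRegular e, slUnit e i₀ i j⁆ =
      ((regularEntry n i - regularEntry n j : ℚ) : K) • slUnit e i₀ i j := by
  apply sl_ext e
  rw [sl.incl_lie, map_sub, LinearMap.toMatrix_mul, LinearMap.toMatrix_mul, map_smul, map_smul,
    toMatrix_slRegular, toMatrix_slUnit]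
  ext p q
  simp only [unitMatrix, if_neg hij, sub_zero, Matrix.sub_apply, Matrix.diagonal_mul,
    Matrix.mul_diagonal, Matrix.smul_apply, Matrix.single_apply, smul_eq_mul]
  split_ifs with h
  · obtain ⟨rfl, rfl⟩ := h; push_cast; ring
  · simp

theorem regularEntry_strictAnti (n : ℕ) : StrictAnti (regularEntry n) := by
  intro i j hij
  have hn : (0 : ℚ) < n := by exact_mod_cast i.pos
  have : (i : ℚ) < j := by exact_mod_cast hij
  simp only [regularEntry]
  nlinarith

theorem slUnit_mem_nPlus (i₀ : Fin n) {i j : Fin n} (hij : i < j) : slUnit e i₀ i j ∈ nPlus e := by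
  intro p q hqp
  rw [toMatrix_slUnit]
  have : ¬ (i = p ∧ j = q) := by rintro ⟨rfl, rfl⟩; exact absurd hij (not_lt.2 hqp)
  simp [unitMatrix, hij.ne, this]

theorem slUnit_mem_diag (i₀ i : Fin n) : slUnit e i₀ i i ∈ diag e := by
  intro p q hpq
  rw [toMatrix_slUnit]
  have : ∀ r, ¬ (r = p ∧ r = q) := by rintro r ⟨rfl, rfl⟩; exact hpq rfl
  simp [unitMatrix, this]

theorem slRegular_mem_diag [CharZero K] : slRegular e ∈ diag e := by
  intro p q hpq
  rw [toMatrix_slRegular, Matrix.diagonal_apply_ne _ hpq]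

theorem lie_altTensor_of_mem_nPlus {x : sl K E} (hx : x ∈ nPlus e) {m : ℕ} (hm : m ≤ n) :
    ⁅x, altTensor K E m fun r => e (Fin.castLE hm r)⁆ = 0 := by
  rw [lie_altTensor]
  refine Finset.sum_eq_zero fun r _ => ?_
  rw [lie_basis, ← AlternatingMap.coe_multilinearMap, MultilinearMap.map_update_sum]
  refine Finset.sum_eq_zero fun p _ => ?_
  rw [MultilinearMap.map_update_smul, AlternatingMap.coe_multilinearMap]
  by_cases hp : Fin.castLE hm r ≤ p
  · rw [hx p _ hp, zero_smul]
  · have hlt : (p : ℕ) < r := not_le.1 hp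
    have hne : r ≠ ⟨p, hlt.trans r.2⟩ := fun h => by
      rw [Fin.ext_iff] at h; exact hlt.ne' h
    have := AlternatingMap.map_update_self (altTensor K E m)
      (fun r => e (Fin.castLE hm r)) hne
    exact (congrArg _ this).trans (smul_zero _)

theorem lie_altTensor_of_mem_diag (x : diag e) {m : ℕ} (hm : m ≤ n) :
    ⁅(x : sl K E), altTensor K E m fun r => e (Fin.castLE hm r)⁆ =
      fundWeight e m x • altTensor K E m fun r => e (Fin.castLE hm r) := by
  have hfund : fundWeight e m x = ∑ r : Fin m, diagEntry e (Fin.castLE hm r) x := by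
    rw [fundWeight, LinearMap.sum_apply]
    symm
    refine Finset.sum_bij (fun r _ => Fin.castLE hm r) (by simp) (by simp) ?_ (by simp)
    intro i hi
    exact ⟨⟨i, by simpa using hi⟩, by simp, rfl⟩
  have hact : ∀ p, ⁅(x : sl K E), e p⁆ = diagEntry e p x • e p := by
    intro p
    rw [lie_basis, Finset.sum_eq_single p]
    · rfl
    · intro q _ hq; rw [x.2 q p hq, zero_smul]
    · simp
  rw [lie_altTensor, hfund, Finset.sum_smul]
  refine Finset.sum_congr rfl fun r _ => ?_
  rw [hact, AlternatingMap.map_update_smul]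
  congr 2
  exact Function.update_eq_self r _

theorem exists_eq_smul_of_mem_flagLine {m : ℕ} (hm : m ≤ n) {w : ⋀[K]^m E}
    (hw : w ∈ flagLine e m) :
    ∃ c : K, w = c • exteriorPower.ιMulti K m fun r => e (Fin.castLE hm r) := by
  have hflag : flagSpace e m = Submodule.span K (Set.range fun r => e (Fin.castLE hm r)) := by
    rw [flagSpace]
    congr 1
    ext y
    constructor
    · rintro ⟨j, hj, rfl⟩; exact ⟨⟨j, hj⟩, rfl⟩
    · rintro ⟨r, rfl⟩; exact ⟨_, r.2, rfl⟩
  rw [flagLine, hflag, exteriorPower.ιMulti_family_span] at hw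
  refine Submodule.mem_span_singleton.1 (Submodule.span_mono ?_ hw) |>.imp fun _ h => h.symm
  rintro _ ⟨s, rfl⟩
  rw [Set.mem_singleton_iff, exteriorPower.ιMulti_family]
  congr 1
  funext r
  have hs : StrictMono (Set.powersetCard.ofFinEmbEquiv.symm s) := OrderEmbedding.strictMono _
  have := (hs.range_inj strictMono_id).1 (by
    rw [(Finite.injective_iff_surjective.1 hs.injective).range_eq, Set.range_id])
  rw [Function.comp_apply, this, id]

end SLaction

section Model

variable {K : Type*} [Field K] {E : Type*} [AddCommGroup E] [Module K E]
  {n : ℕ} (e : Module.Basis (Fin n) K E) {k : ℕ} (l ns : Fin k → ℕ)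

variable (K E) in
/-- The tensor space projecting onto `W K E l ns`. -/
abbrev TensorModel : Type _ := ⨂[K] i, ⨂[K] _ : Fin (l i), ⨂[K] _ : Fin (ns i), E

/-- The monomial basis of the tensor space. -/
def modelBasis : Module.Basis (∀ i, Fin (l i) → Fin (ns i) → Fin n) K (TensorModel K E l ns) :=
  Basis.piTensorProduct fun i => Basis.piTensorProduct fun _ : Fin (l i) =>
    Basis.piTensorProduct fun _ : Fin (ns i) => e

variable (K E) in
/-- The projection of the tensor space onto `W K E l ns`. -/
def modelProj : TensorModel K E l ns →ₗ⁅K, sl K E⁆ W K E l ns :=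
  tensorMap fun i => (tensorToSymPow K (sl K E) (⋀[K]^(ns i) E) (l i)).comp
    (tensorMap fun _ => tensorToExterior K (sl K E) E (ns i))

variable (hns : ∀ i, ns i < n)

/-- The tensor product of antisymmetrizations of `e₁ ⊗ ⋯ ⊗ e_{nᵢ}`. -/
def modelVec : TensorModel K E l ns :=
  PiTensorProduct.tprod K fun i => PiTensorProduct.tprod K fun _ : Fin (l i) =>
    altTensor K E (ns i) fun r => e (Fin.castLE (hns i).le r)

theorem isRationalVec_modelVec [CharZero K] :
    IsRationalVec (modelBasis e l ns) (modelVec e l ns hns) :=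
  IsRationalVec.tprod fun _ => IsRationalVec.tprod fun _ => isRationalVec_altTensor fun r p =>
    ⟨if Fin.castLE (hns _).le r = p then 1 else 0, by
      simp [Finsupp.single_apply, apply_ite (Rat.cast : ℚ → K)]⟩

theorem lie_modelVec_of_mem_diag (x : diag e) : ⁅(x : sl K E), modelVec e l ns hns⁆ =
    (∑ i, l i • fundWeight e (ns i)) x • modelVec e l ns hns := by
  rw [modelVec, lie_tprod_of_eigen fun i => lie_tprod_of_eigen fun _ =>
    lie_altTensor_of_mem_diag e x (hns i).le]
  simp [LinearMap.sum_apply]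

theorem lie_modelVec_of_mem_nPlus {x : sl K E} (hx : x ∈ nPlus e) :
    ⁅x, modelVec e l ns hns⁆ = 0 := by
  have h : ∀ i, ⁅x, altTensor K E (ns i) fun r => e (Fin.castLE (hns i).le r)⁆ =
      (0 : K) • altTensor K E (ns i) fun r => e (Fin.castLE (hns i).le r) := fun i => by
    rw [lie_altTensor_of_mem_nPlus e hx, zero_smul]
  rw [modelVec, lie_tprod_of_eigen fun i => lie_tprod_of_eigen fun _ => h i]
  simp

theorem isTransposePair_modelBasis [CharZero K] (i₀ i j : Fin n) :
    IsTransposePair (M := TensorModel K E l ns) (modelBasis e l ns) (slUnit e i₀ i j) (slUnit e i₀ j i) :=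
  IsTransposePair.piTensorProduct fun _ => IsTransposePair.piTensorProduct fun _ =>
    IsTransposePair.piTensorProduct fun _ => isTransposePair_slUnit e i₀ i j

theorem exists_actsDiagonally_modelBasis [CharZero K] :
    ∃ d, ActsDiagonally (M := TensorModel K E l ns) (modelBasis e l ns) (slRegular e) d := by
  have h1 := fun i : Fin k => ActsDiagonally.piTensorProduct fun _ : Fin (ns i) =>
    actsDiagonally_slRegular e
  have h2 := fun i : Fin k => ActsDiagonally.piTensorProduct fun _ : Fin (l i) => h1 i
  exact ⟨_, ActsDiagonally.piTensorProduct h2⟩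

theorem model_eq_bot_or_mem [CharZero K] (U : LieSubmodule K (sl K E) (TensorModel K E l ns))
    (hU : U ≤ LieSubmodule.lieSpan K (sl K E) {modelVec e l ns hns}) :
    U = ⊥ ∨ modelVec e l ns hns ∈ U := by
  obtain ⟨μ, hμ⟩ : ∃ μ : ℚ, (∑ i, l i • fundWeight e (ns i)) ⟨slRegular e, slRegular_mem_diag e⟩ =
      (μ : K) := by
    refine ⟨∑ i, l i * ∑ j ∈ Finset.univ.filter (fun j : Fin n => (j : ℕ) < ns i),
      regularEntry n j, ?_⟩
    simp [LinearMap.sum_apply, fundWeight, diagEntry, toMatrix_slRegular]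
  obtain ⟨d, hd⟩ := exists_actsDiagonally_modelBasis e l ns
  refine eq_bot_or_mem_of_le_lieSpan (modelBasis e l ns) (span_slUnit e) ?_
    hd
    (isRationalVec_modelVec e l ns hns) (μ := μ) ?_ ?_ U hU
  · rintro _ ⟨i₀, i, j, rfl⟩
    exact ⟨_, isTransposePair_modelBasis e l ns i₀ i j⟩
  · rw [← hμ]
    exact lie_modelVec_of_mem_diag e l ns hns ⟨slRegular e, slRegular_mem_diag e⟩
  · rintro _ ⟨i₀, i, j, rfl⟩
    rcases lt_trichotomy i j with h | rfl | h
    · left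
      rw [lie_modelVec_of_mem_nPlus e l ns hns (slUnit_mem_nPlus e i₀ h)]
      exact zero_mem _
    · left
      rw [lie_modelVec_of_mem_diag e l ns hns ⟨_, slUnit_mem_diag e i₀ i⟩]
      exact Submodule.smul_mem _ _ (Submodule.mem_span_singleton_self _)
    · right
      refine ⟨regularEntry n j - regularEntry n i, sub_pos.2 (regularEntry_strictAnti n h), ?_⟩
      rw [slRegular_lie_slUnit e i₀ h.ne']
      push_cast
      rw [neg_sub]

theorem exists_modelProj_modelVec [CharZero K] {w : ∀ i, ⋀[K]^(ns i) E}
    (hw : ∀ i, w i ∈ flagLine e (ns i)) (hw0 : ∀ i, w i ≠ 0) :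
    ∃ c : K, c ≠ 0 ∧ hwVec l ns w = c • modelProj K E l ns (modelVec e l ns hns) := by
  choose c hc using fun i => exists_eq_smul_of_mem_flagLine e (hns i).le (hw i)
  have hc0 : ∀ i, c i ≠ 0 := fun i h => hw0 i (by rw [hc i, h, zero_smul])
  have hfac : ∀ i, ((ns i).factorial : K) ≠ 0 := fun i =>
    Nat.cast_ne_zero.2 (Nat.factorial_ne_zero _)
  refine ⟨∏ i, (c i * ((ns i).factorial : K)⁻¹) ^ l i, Finset.prod_ne_zero_iff.2 fun i _ =>
    pow_ne_zero _ (mul_ne_zero (hc0 i) (inv_ne_zero (hfac i))), ?_⟩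
  rw [modelProj, modelVec, tensorMap_tprod, ← MultilinearMap.map_smul_univ, hwVec]
  congr 1
  funext i
  rw [LieModuleHom.comp_apply, tensorMap_tprod, tensorToExterior_altTensor,
    tensorToSymPow_tprod_const, ← symPowElem_smul]
  congr 1
  rw [hc i, ← Nat.cast_smul_eq_nsmul K, smul_smul, mul_assoc, inv_mul_cancel₀ (hfac i), mul_one]

end Model

section Image

variable {K : Type*} [Field K] {L : Type*} [LieRing L]
  {M : Type*} [AddCommGroup M] [Module K M] [LieRingModule L M]
  {N : Type*} [AddCommGroup N] [Module K N] [LieRingModule L N]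

theorem lieSpan_le_map_lieSpan (f : M →ₗ⁅K, L⁆ N) (v : M) :
    LieSubmodule.lieSpan K L {f v} ≤ (LieSubmodule.lieSpan K L {v}).map f :=
  LieSubmodule.lieSpan_le.2 (Set.singleton_subset_iff.2
    ⟨v, LieSubmodule.subset_lieSpan rfl, rfl⟩)

theorem eq_bot_or_map_mem_of_le_lieSpan (f : M →ₗ⁅K, L⁆ N) {v : M}
    (h : ∀ U ≤ LieSubmodule.lieSpan K L {v}, U = ⊥ ∨ v ∈ U)
    (U : LieSubmodule K L N) (hU : U ≤ LieSubmodule.lieSpan K L {f v}) : U = ⊥ ∨ f v ∈ U := by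
  rcases h (U.comap f ⊓ LieSubmodule.lieSpan K L {v}) inf_le_right with h | h
  · left
    rw [LieSubmodule.eq_bot_iff]
    intro u hu
    obtain ⟨t, ht, rfl⟩ := lieSpan_le_map_lieSpan f v (hU hu)
    have : t ∈ U.comap f ⊓ LieSubmodule.lieSpan K L {v} := ⟨hu, ht⟩
    rw [h, LieSubmodule.mem_bot] at this
    subst this
    exact map_zero f
  · exact Or.inr h.1

theorem isIrreducible_lieSpan {v : M} (hv : v ≠ 0)
    (h : ∀ U ≤ LieSubmodule.lieSpan K L {v}, U = ⊥ ∨ v ∈ U) :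
    LieModule.IsIrreducible K L (LieSubmodule.lieSpan K L {v}) := by
  have : Nontrivial (LieSubmodule.lieSpan K L {v}) :=
    ⟨⟨v, LieSubmodule.subset_lieSpan rfl⟩, 0, fun h => hv (congrArg Subtype.val h)⟩
  refine LieModule.IsIrreducible.mk fun U hU => ?_
  rcases h (U.map (LieSubmodule.lieSpan K L {v}).incl) (LieSubmodule.map_incl_le) with h | h
  · exfalso
    refine hU ((LieSubmodule.eq_bot_iff _).2 fun u hu => ?_)
    have : (u : M) ∈ U.map (LieSubmodule.lieSpan K L {v}).incl := ⟨u, hu, rfl⟩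
    rw [h, LieSubmodule.mem_bot] at this
    exact Subtype.ext this
  · refine eq_top_iff.2 fun u _ => ?_
    have hle : LieSubmodule.lieSpan K L {v} ≤ U.map (LieSubmodule.lieSpan K L {v}).incl :=
      LieSubmodule.lieSpan_le.2 (Set.singleton_subset_iff.2 h)
    obtain ⟨u', hu', heq⟩ := hle u.2
    rwa [← Subtype.ext (a1 := u') (a2 := u) heq]

theorem lieSpan_singleton_mk_eq_top (v : M) :
    LieSubmodule.lieSpan K L {(⟨v, LieSubmodule.subset_lieSpan rfl⟩ :
      LieSubmodule.lieSpan K L {v})} = ⊤ := by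
  refine eq_top_iff.2 fun u _ => ?_
  obtain ⟨u', hu', heq⟩ := lieSpan_le_map_lieSpan (LieSubmodule.lieSpan K L {v}).incl
    ⟨v, LieSubmodule.subset_lieSpan rfl⟩ u.2
  rwa [← Subtype.ext (a1 := u') (a2 := u) heq]

end Image

section Main

variable {K : Type*} [Field K] [CharZero K] {E : Type*} [AddCommGroup E] [Module K E]
  {n : ℕ} (e : Module.Basis (Fin n) K E) {k : ℕ} {l ns : Fin k → ℕ} (hns : ∀ i, ns i < n)
  {w : ∀ i, ⋀[K]^(ns i) E} (hw : ∀ i, w i ∈ flagLine e (ns i)) (hw0 : ∀ i, w i ≠ 0)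

theorem hwVec_ne_zero {K : Type*} [Field K] {E : Type*} [AddCommGroup E] [Module K E] {k : ℕ}
    {l ns : Fin k → ℕ} {w : ∀ i, ⋀[K]^(ns i) E} (hw0 : ∀ i, w i ≠ 0) : hwVec l ns w ≠ 0 :=
  tprod_ne_zero fun i => symPowElem_ne_zero (l i) (hw0 i)

include hns hw hw0 in
theorem exists_lieModuleHom_modelVec : ∃ f : TensorModel K E l ns →ₗ⁅K, sl K E⁆ W K E l ns,
    f (modelVec e l ns hns) = hwVec l ns w := by
  obtain ⟨c, -, hcv⟩ := exists_modelProj_modelVec e l ns hns hw hw0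
  exact ⟨c • modelProj K E l ns, hcv.symm⟩

include hns hw hw0

theorem finiteDimensional_V : FiniteDimensional K (V l ns w) := by
  obtain ⟨f, hf⟩ := exists_lieModuleHom_modelVec (l := l) e hns hw hw0
  have : FiniteDimensional K (TensorModel K E l ns) :=
    (modelBasis e l ns).finiteDimensional_of_finite
  have hle : (V l ns w).toSubmodule ≤
      LinearMap.range (f : TensorModel K E l ns →ₗ[K] W K E l ns) := by
    rw [V, ← hf]
    exact fun u hu => (lieSpan_le_map_lieSpan f _ hu).imp fun _ h => h.2
  exact Submodule.finiteDimensional_of_le (V := W K E l ns) hle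

theorem isIrreducible_V : LieModule.IsIrreducible K (sl K E) (V l ns w) := by
  refine isIrreducible_lieSpan (hwVec_ne_zero hw0) ?_
  obtain ⟨f, hf⟩ := exists_lieModuleHom_modelVec (l := l) e hns hw hw0
  rw [← hf]
  exact eq_bot_or_map_mem_of_le_lieSpan f (model_eq_bot_or_mem e l ns hns)

theorem isHighestWeightVector_hwVecV :
    IsHighestWeightVector e (hwVecV l ns w) (∑ i, l i • fundWeight e (ns i)) := by
  obtain ⟨f, hf⟩ := exists_lieModuleHom_modelVec (l := l) e hns hw hw0
  refine ⟨fun h => hwVec_ne_zero hw0 (congrArg Subtype.val h), fun x => Subtype.ext ?_,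
    fun x hx => Subtype.ext ?_, lieSpan_singleton_mk_eq_top _⟩
  · change ⁅(x : sl K E), hwVec l ns w⁆ = _ • hwVec l ns w
    rw [← hf, ← LieModuleHom.map_lie, lie_modelVec_of_mem_diag, map_smul]
  · change ⁅x, hwVec l ns w⁆ = 0
    rw [← hf, ← LieModuleHom.map_lie, lie_modelVec_of_mem_nPlus e l ns hns hx, map_zero]

end Main

end SLHighest

end

theorem mainTheorem4 {K : Type*} [Field K] [IsAlgClosed K] [CharZero K]
    {E : Type*} [AddCommGroup E] [Module K E] {n : ℕ} (e : Module.Basis (Fin n) K E)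
    {k : ℕ} (l ns : Fin k → ℕ) (hl : ∀ i, 1 ≤ l i)
    (hns : StrictMono ns) (hns_pos : ∀ i, 1 ≤ ns i) (hns_lt : ∀ i, ns i < n)
    (w : ∀ i, ⋀[K]^(ns i) E) (hw : ∀ i, w i ∈ SLHighest.flagLine e (ns i))
    (hw0 : ∀ i, w i ≠ 0) :
    FiniteDimensional K (SLHighest.V l ns w) ∧
      LieModule.IsIrreducible K (SLHighest.sl K E) (SLHighest.V l ns w) ∧
      SLHighest.IsHighestWeightVector e (SLHighest.hwVecV l ns w)
        (∑ i, l i • SLHighest.fundWeight e (ns i)) :=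
  ⟨SLHighest.finiteDimensional_V e hns_lt hw hw0, SLHighest.isIrreducible_V e hns_lt hw hw0,
    SLHighest.isHighestWeightVector_hwVecV e hns_lt hw hw0⟩
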